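/- Let $0<x<1$. A REM$_x$ process is a Poisson point process on $[0,\infty)$ with intensity measure $\rho_x(d\xi)=-d(\xi^{-x})=x\,\xi^{-x-1}d\xi$ on $(0,\infty)$ (and no mass at $0$): the occupation numbers $N_A$ of disjoint Borel sets $A$ are independent, and $N_A$ is Poisson distributed with mean $\rho_x(A)$. Let $\{\xi_n\}_{n\ge 1}$ be the points of a REM$_x$ process, labelled in descending order, $\xi_1>\xi_2>\cdots$ almost surely. Let $g$ be a probability measure on $[0,\infty)$ with $$0<\langle\gamma^x\rangle:=\int\gamma^x\,g(d\gamma)<\infty ,$$ and let $\{\gamma_n\}_{n\ge 1}$ be i.i.d. random variables with law $g$, the sequence being independent of $\{\xi_n\}$. Then almost surely the nonzero points of the configuration $\{\gamma_n\xi_n\}$ can be relabelled, in exactly one way, in strictly descending order: there is a unique injective $\pi:\mathbb N\to\mathbb N$ with range $\{k:\gamma_k\xi_k\neq 0\}$ (a permutation if $g(\{0\})=0$) such that $$\widetilde\xi_n:=\gamma_{\pi(n)}\,\xi_{\pi(n)}$$ is strictly decreasing in $n$. Put $\widetilde\gamma_n:=\gamma_{\pi(n)}$ and $K:=\langle\gamma^x\rangle^{1/x}$.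 Then: 1. The sequences $\{K^{-1}\widetilde\xi_n\}_{n\ge1}$ and $\{\xi_n\}_{n\ge1}$ have the same distribution, so that after rescaling by $K$ the process is again REM$_x$. 2. The random variables $\widetilde\gamma_1,\widetilde\gamma_2,\dots$ are i.i.d. with law $$\widetilde g(d\gamma)=\frac{\gamma^x\,g(d\gamma)}{\langle\gamma^x\rangle}.$$ 3. The sequence $\{\widetilde\gamma_n\}$ is independent of the sequence $\{\widetilde\xi_n\}$. -/

import Mathlib

open MeasureTheory ProbabilityTheory Set

noncomputable section

/-- The measure `-d ξ⁻ˣ = x ξ⁻ˣ⁻¹ dξ` carried by `(0, ∞)`, so that `[ε, ∞)` has mass `ε⁻ˣ` for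
`0 < ε` (when `0 < x`). -/
def remIntensity (x : ℝ) : Measure ℝ :=
  (volume.restrict (Ioi (0 : ℝ))).withDensity
    (fun t => ENNReal.ofReal (x * t ^ (-x - 1)))

/-- The number of points of the configuration `p` that lie in `A`, counted with multiplicity. -/
def occupationNumber (p : ℕ → ℝ) (A : Set ℝ) : ℕ∞ := {n | p n ∈ A}.encard

/-- The random configuration `ξ 0, ξ 1, …` is a Poisson point process with intensity
`remIntensity x`. No order of the points is required here.
The sets `A` may meet `(-∞, 0]`, which has intensity zero and thus carries no points. A set of
infinite intensity almost surely contains infinitely many points: this follows from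
the two conditions, applied to its pieces of finite intensity. -/
structure IsREM {Ω : Type*} [MeasurableSpace Ω] (x : ℝ) (ξ : ℕ → Ω → ℝ) (μ : Measure Ω) :
    Prop where
  aemeasurable : ∀ n, AEMeasurable (ξ n) μ
  /-- The occupation numbers of disjoint Borel sets are independent. -/
  indep : ∀ A : ℕ → Set ℝ, (∀ i, MeasurableSet (A i)) →
    Pairwise (fun i j => Disjoint (A i) (A j)) →
    iIndepFun (fun i ω => occupationNumber (fun n => ξ n ω) (A i)) μ
  /-- The occupation number of a Borel set is Poisson distributed. -/
  poisson : ∀ A : Set ℝ, MeasurableSet A → remIntensity x A ≠ ⊤ → ∀ k : ℕ,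
    μ {ω | occupationNumber (fun n => ξ n ω) A = k} =
      ENNReal.ofReal ((remIntensity x A).toReal ^ k / (k.factorial : ℝ) *
        Real.exp (-(remIntensity x A).toReal))

/-- `σ` lists the indices of the nonzero points of the configuration `w`, each of them once, in
such a way that the points are listed in descending order. If no point of `w` is zero,
then `σ` is a permutation. -/
structure IsDescendingRelabelling (w : ℕ → ℝ) (σ : ℕ → ℕ) : Prop where
  bijOn : BijOn σ univ {k | w k ≠ 0}
  strictAnti : StrictAnti (fun n => w (σ n))

/-- The probability measure `γˣ g(dγ) / ⟨γˣ⟩`. -/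
def tiltedLaw (x : ℝ) (g : Measure ℝ) : Measure ℝ :=
  g.withDensity (fun c => ENNReal.ofReal (c ^ x / ∫ y, y ^ x ∂g))

end

/-!
The proof compares two marked point processes through their laws. On one side stand the points
`γₙξₙ` with marks `γₙ`; on the other the points `Kξₙ` with marks `γ'ₙ` that are i.i.d. with the
tilted law and independent of `ξ`. Both are Poisson processes on pairs (position, mark): with
`ρ` the intensity of `ξ`, they have as intensities the images of `ρ ⊗ g` under
`(t, c) ↦ (c t, c)` and of `ρ ⊗ g̃` under `(t, c) ↦ (K t, c)`. Off position zero these agree,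
because dilation by `c` multiplies `ρ` by `cˣ` and `Kˣ = ⟨γˣ⟩`
(`lintegral_remIntensity_mul_mark`). As the second process is listed in descending order already,
the descending relabelling of the first must have the law of `(Kξₙ, γ'ₙ)`, and all the claims
can be read off from that product law.

A process enters only through the functionals `E ∏ₙ φ(wₙ)` with `0 ≤ φ ≤ 1`. For a Poisson process
they depend on the intensity alone (`IsREM.lintegral_productFunctional`, by approximation with
simple functions), and i.i.d. marks may be averaged out factor by factor
(`IsREM.lintegral_productFunctional_marked`). Since products of such `φ` are again of this kind, the
functionals give all joint moments of the numbers `2^{-N(B)}`, where `N(B)` counts the points in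
`B`; hence they determine the joint law of the counts over a countable family of sets `B`
(`map_countVector_eq`).

Finally, the counts determine a configuration listed in descending order, and measurably so by the
Lusin–Souslin theorem (`exists_measurable_leftInvOn_countVector`). Moreover, a configuration whose
counts are those of a descending one is a rearrangement of it (`exists_relabelling`). As the counts
of `(γₙξₙ, γₙ)` have the law of those of the descending `(Kξₙ, γ'ₙ)`, it follows without a separate
argument that the `γₙξₙ` have no ties, accumulate only at zero, and include infinitely many
nonzero points.
-/

open scoped ENNReal

/-! ### Product functionals of a configuration -/

/-- The product `∏ φ(wₙ)` over all points of the configuration `w`, as the infimum of the partial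
products. It is used for `φ ≤ 1` only, where the partial products decrease. -/
noncomputable def productFunctional {E : Type*} (φ : E → ℝ≥0∞) (w : ℕ → E) : ℝ≥0∞ :=
  ⨅ N : ℕ, ∏ n ∈ Finset.range N, φ (w n)

section ProductFunctional

variable {E : Type*} {φ ψ : E → ℝ≥0∞} {w : ℕ → E}

lemma antitone_prod_range (hφ : ∀ z, φ z ≤ 1) :
    Antitone (fun N => ∏ n ∈ Finset.range N, φ (w n)) :=
  fun _ _ h => Finset.prod_le_prod_of_subset_of_le_one' (Finset.range_mono h) fun _ _ _ => hφ _

lemma productFunctional_le_prod (hφ : ∀ z, φ z ≤ 1) (s : Finset ℕ) :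
    productFunctional φ w ≤ ∏ n ∈ s, φ (w n) := by
  obtain ⟨N, hN⟩ := s.exists_nat_subset_range
  exact (iInf_le _ N).trans
    (Finset.prod_le_prod_of_subset_of_le_one' hN fun _ _ _ => hφ _)

lemma productFunctional_le_one : productFunctional φ w ≤ 1 :=
  (iInf_le _ 0).trans (by simp)

lemma productFunctional_ne_top : productFunctional φ w ≠ ⊤ :=
  ne_top_of_le_ne_top ENNReal.one_ne_top productFunctional_le_one

lemma productFunctional_one : productFunctional (fun _ : E => 1) w = 1 := by
  simp [productFunctional]

lemma measurable_productFunctional [MeasurableSpace E] (hφ : Measurable φ) :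
    Measurable (productFunctional φ) :=
  .iInf fun N => Finset.measurable_prod (Finset.range N)
    fun n _ => hφ.comp (measurable_pi_apply n)

lemma productFunctional_mul (hφ : ∀ z, φ z ≤ 1) (hψ : ∀ z, ψ z ≤ 1) :
    productFunctional (fun z => φ z * ψ z) w =
      productFunctional φ w * productFunctional ψ w := by
  have h := ENNReal.Tendsto.mul (tendsto_atTop_iInf (antitone_prod_range (w := w) hφ))
    (.inr (productFunctional_ne_top (φ := ψ) (w := w)))
    (tendsto_atTop_iInf (antitone_prod_range (w := w) hψ))
    (.inr (productFunctional_ne_top (φ := φ) (w := w)))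
  simp_rw [← Finset.prod_mul_distrib] at h
  exact tendsto_nhds_unique
    (tendsto_atTop_iInf (antitone_prod_range fun z => mul_le_one' (hφ z) (hψ z))) h

lemma list_prod_map_le_one {ι : Type*} {f : ι → ℝ≥0∞} (hf : ∀ i, f i ≤ 1) (l : List ι) :
    (l.map f).prod ≤ 1 := by
  induction l with
  | nil => simp
  | cons i l ih => simpa using mul_le_one' (hf i) ih

lemma productFunctional_list_prod {ι : Type*} {φ : ι → E → ℝ≥0∞} (hφ : ∀ i z, φ i z ≤ 1)
    (l : List ι) :
    productFunctional (fun z => (l.map fun i => φ i z).prod) w =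
      (l.map fun i => productFunctional (φ i) w).prod := by
  induction l with
  | nil => simpa using productFunctional_one
  | cons i l ih =>
    simp only [List.map_cons, List.prod_cons]
    rw [productFunctional_mul (hφ i) (fun z => list_prod_map_le_one (fun j => hφ j z) l), ih]

lemma productFunctional_eq_prod (hφ : ∀ z, φ z ≤ 1) (s : Finset ℕ)
    (h1 : ∀ k ∉ s, φ (w k) = 1) :
    productFunctional φ w = ∏ n ∈ s, φ (w n) := by
  refine le_antisymm (productFunctional_le_prod hφ s) (le_iInf fun N => ?_)
  calc ∏ n ∈ s, φ (w n) ≤ ∏ n ∈ s ∩ Finset.range N, φ (w n) :=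
        Finset.prod_le_prod_of_subset_of_le_one' Finset.inter_subset_left fun _ _ _ => hφ _
    _ = _ := Finset.prod_subset Finset.inter_subset_right fun k hk hk' =>
        h1 k fun h => hk' (Finset.mem_inter.2 ⟨h, hk⟩)

/-- The weight that halves the product at each point in `B`. -/
noncomputable def halfOn (B : Set E) : E → ℝ≥0∞ := B.indicator (fun _ => 2⁻¹) + Bᶜ.indicator 1

lemma halfOn_of_mem {B : Set E} {z : E} (hz : z ∈ B) : halfOn B z = 2⁻¹ := by simp [halfOn, hz]

lemma halfOn_of_notMem {B : Set E} {z : E} (hz : z ∉ B) : halfOn B z = 1 := by simp [halfOn, hz]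

lemma halfOn_le_one (B : Set E) (z : E) : halfOn B z ≤ 1 := by
  by_cases hz : z ∈ B
  · simp [halfOn_of_mem hz]
  · simp [halfOn_of_notMem hz]

lemma measurable_halfOn [MeasurableSpace E] {B : Set E} (hB : MeasurableSet B) :
    Measurable (halfOn B) :=
  (measurable_const.indicator hB).add (measurable_one.indicator hB.compl)

lemma productFunctional_halfOn_of_finite {B : Set E} (h : (w ⁻¹' B).Finite) :
    productFunctional (halfOn B) w = 2⁻¹ ^ (w ⁻¹' B).ncard := by
  rw [productFunctional_eq_prod (halfOn_le_one B) h.toFinset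
    fun k hk => halfOn_of_notMem (by simpa using hk),
    Set.ncard_eq_toFinset_card _ h, Finset.prod_congr rfl fun k hk => halfOn_of_mem (B := B)
      (by simpa using hk), Finset.prod_const]

lemma productFunctional_halfOn_of_infinite {B : Set E} (h : (w ⁻¹' B).Infinite) :
    productFunctional (halfOn B) w = 0 := by
  have key : ∀ k : ℕ, productFunctional (halfOn B) w ≤ 2⁻¹ ^ k := by
    intro k
    obtain ⟨s, hs, rfl⟩ := h.exists_subset_card_eq k
    refine (productFunctional_le_prod (halfOn_le_one B) s).trans_eq ?_
    rw [Finset.prod_congr rfl fun k hk => halfOn_of_mem (B := B) (hs hk), Finset.prod_const]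
  exact le_antisymm (ge_of_tendsto' (ENNReal.tendsto_pow_atTop_nhds_zero_of_lt_one (by simp)) key)
    zero_le

/-- If the weights `halfOn B` have the same product over `w` and over `v`, then `w` and `v` have
equally many points in `B`. -/
lemma encard_preimage_eq_of_productFunctional_halfOn_eq {B : Set E} {v : ℕ → E}
    (h : productFunctional (halfOn B) w = productFunctional (halfOn B) v) :
    (w ⁻¹' B).encard = (v ⁻¹' B).encard := by
  have hpos : ∀ k : ℕ, (2⁻¹ : ℝ≥0∞) ^ k ≠ 0 := fun k => pow_ne_zero _ (by simp)
  rcases (w ⁻¹' B).finite_or_infinite with hw | hw <;>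
    rcases (v ⁻¹' B).finite_or_infinite with hv | hv
  · rw [productFunctional_halfOn_of_finite hw, productFunctional_halfOn_of_finite hv] at h
    have h' := congrArg ENNReal.toReal h
    simp only [ENNReal.toReal_pow] at h'
    rw [← hw.cast_ncard_eq, ← hv.cast_ncard_eq,
      pow_right_injective₀ (by simp) (by simp) h']
  · rw [productFunctional_halfOn_of_finite hw, productFunctional_halfOn_of_infinite hv] at h
    exact absurd h (hpos _)
  · rw [productFunctional_halfOn_of_infinite hw, productFunctional_halfOn_of_finite hv] at h
    exact absurd h.symm (hpos _)
  · rw [hw.encard_eq, hv.encard_eq]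

end ProductFunctional

/-! ### The Poisson product formula -/

section Poisson

variable {Ω : Type*} [MeasurableSpace Ω] {μ : Measure Ω}

lemma measurable_encard_preimage {E : Type*} [MeasurableSpace E] {A : Set E}
    (hA : MeasurableSet A) : Measurable (fun w : ℕ → E => {n | w n ∈ A}.encard) :=
  measurable_encard.comp <| measurable_set_iff.2 fun n => hA.mem.comp (measurable_pi_apply n)

variable {N : Ω → ℕ∞} {r : ℝ}

lemma hasSum_poisson {r : ℝ} (hr : 0 ≤ r) :
    HasSum (fun k : ℕ => r ^ k / k.factorial * Real.exp (-r)) 1 := by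
  lift r to NNReal using hr
  refine (hasSum_one_poissonMeasure r).congr_fun fun k => ?_
  ring

/-- The point probabilities at the natural numbers leave no mass for the value `⊤`. -/
lemma ae_ne_top_of_poisson [IsProbabilityMeasure μ] (hN : AEMeasurable N μ) (hr : 0 ≤ r)
    (h : ∀ k : ℕ, μ {ω | N ω = k} = ENNReal.ofReal (r ^ k / k.factorial * Real.exp (-r))) :
    ∀ᵐ ω ∂μ, N ω ≠ ⊤ := by
  have : IsProbabilityMeasure (μ.map N) := Measure.isProbabilityMeasure_map hN
  have h1 : μ.map N (range ((↑) : ℕ → ℕ∞)) = 1 := by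
    have hu : range ((↑) : ℕ → ℕ∞) = ⋃ k : ℕ, {(k : ℕ∞)} := by ext; simp
    rw [hu, measure_iUnion (fun i j hij => by simpa using hij) fun _ => .of_discrete]
    have hk : ∀ k : ℕ, μ.map N {(k : ℕ∞)} =
        ENNReal.ofReal (r ^ k / k.factorial * Real.exp (-r)) := fun k => by
      rw [Measure.map_apply_of_aemeasurable hN .of_discrete, ← h k]; rfl
    have hs := hasSum_poisson hr
    simp_rw [hk]
    rw [← ENNReal.ofReal_tsum_of_nonneg (fun _ => by positivity) hs.summable, hs.tsum_eq,
      ENNReal.ofReal_one]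
  have h2 : ∀ᵐ n ∂(μ.map N), n ∈ range ((↑) : ℕ → ℕ∞) :=
    (prob_compl_eq_zero_iff .of_discrete).2 h1
  filter_upwards [ae_of_ae_map hN h2] with ω hω
  obtain ⟨k, hk⟩ := hω
  simp [← hk]

/-- The generating function of the Poisson law: `E[(1 - y)ᴺ] = exp (-y r)`. -/
lemma lintegral_one_sub_pow_of_poisson [IsProbabilityMeasure μ] (hN : AEMeasurable N μ)
    (hr : 0 ≤ r)
    (h : ∀ k : ℕ, μ {ω | N ω = k} = ENNReal.ofReal (r ^ k / k.factorial * Real.exp (-r)))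
    {y : ℝ≥0∞} (hy : y ≤ 1) :
    ∫⁻ ω, (1 - y) ^ (N ω).toNat ∂μ = ENNReal.ofReal (Real.exp (-(y.toReal * r))) := by
  have hk : ∀ k : ℕ, μ.map N {(k : ℕ∞)} =
      ENNReal.ofReal (r ^ k / k.factorial * Real.exp (-r)) := fun k => by
    rw [Measure.map_apply_of_aemeasurable hN .of_discrete, ← h k]; rfl
  have htop : μ.map N {⊤} = 0 := by
    rw [Measure.map_apply_of_aemeasurable hN .of_discrete]
    have := ae_iff.1 (ae_ne_top_of_poisson hN hr h)
    simp only [not_not] at this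
    exact this
  obtain ⟨s, hs0, hs1, hs⟩ : ∃ s : ℝ, 0 ≤ s ∧ 1 - y = ENNReal.ofReal s ∧ s = 1 - y.toReal := by
    refine ⟨(1 - y).toReal, ENNReal.toReal_nonneg, (ENNReal.ofReal_toReal ?_).symm, ?_⟩
    · exact (tsub_le_self.trans_lt ENNReal.one_lt_top).ne
    · rw [ENNReal.toReal_sub_of_le hy ENNReal.one_ne_top, ENNReal.toReal_one]
  have hsum := (hasSum_poisson (r := r * s) (by positivity)).mul_right
    (Real.exp (-(y.toReal * r)))
  rw [← lintegral_map' (f := fun n : ℕ∞ => (1 - (y : ℝ≥0∞)) ^ n.toNat)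
    (Measurable.of_discrete).aemeasurable hN, lintegral_countable',
    ← (Nat.cast_injective (R := ℕ∞)).tsum_eq]
  · have hterm : ∀ k : ℕ, (1 - y) ^ (k : ℕ∞).toNat * μ.map N {(k : ℕ∞)} = ENNReal.ofReal
        ((r * s) ^ k / k.factorial * Real.exp (-(r * s)) * Real.exp (-(y.toReal * r))) := by
      intro k
      rw [hk, ENat.toNat_natCast, hs1, ← ENNReal.ofReal_pow hs0,
        ← ENNReal.ofReal_mul (by positivity)]
      congr 1
      have : Real.exp (-r) = Real.exp (-(r * s)) * Real.exp (-(y.toReal * r)) := by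
        rw [← Real.exp_add, hs]; ring_nf
      rw [this]
      ring
    simp_rw [hterm]
    rw [one_mul] at hsum
    rw [← ENNReal.ofReal_tsum_of_nonneg (fun _ => by positivity) hsum.summable, hsum.tsum_eq]
  · intro n hn
    induction n using ENat.recTopCoe with
    | top => simp [htop] at hn
    | coe k => exact ⟨k, rfl⟩

/-- Independent nonnegative functions: the expectation of the product is the product of the
expectations. -/
lemma lintegral_finset_prod_of_iIndepFun {ι : Type*} (s : Finset ι) {X : ι → Ω → ℝ≥0∞}
    (hX : iIndepFun X μ) (hm : ∀ i, AEMeasurable (X i) μ) :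
    ∫⁻ ω, ∏ i ∈ s, X i ω ∂μ = ∏ i ∈ s, ∫⁻ ω, X i ω ∂μ := by
  have h := lintegral_prod_eq_prod_lintegral_of_indepFun s (fun i => (hm i).mk (X i))
    (hX.congr fun i => (hm i).ae_eq_mk) fun i => (hm i).measurable_mk
  have hae : ∀ᵐ ω ∂μ, ∀ i ∈ s, X i ω = (hm i).mk (X i) ω :=
    (Finset.eventually_all s).2 fun i _ => (hm i).ae_eq_mk
  rw [Finset.prod_congr rfl fun i _ => lintegral_congr_ae (hm i).ae_eq_mk, ← h]
  refine lintegral_congr_ae ?_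
  filter_upwards [hae] with ω hω
  exact Finset.prod_congr rfl hω

end Poisson

section REM

variable {Ω : Type*} [MeasurableSpace Ω] {μ : Measure Ω} {x : ℝ} {ξ : ℕ → Ω → ℝ}

lemma IsREM.aemeasurable_occupationNumber (hξ : IsREM x ξ μ) {A : Set ℝ} (hA : MeasurableSet A) :
    AEMeasurable (fun ω => occupationNumber (fun n => ξ n ω) A) μ :=
  (measurable_encard_preimage hA).comp_aemeasurable (aemeasurable_pi_iff.2 hξ.aemeasurable)

lemma IsREM.ae_finite [IsProbabilityMeasure μ] (hξ : IsREM x ξ μ) {A : Set ℝ}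
    (hA : MeasurableSet A) (hA' : remIntensity x A ≠ ⊤) :
    ∀ᵐ ω ∂μ, {n | ξ n ω ∈ A}.Finite := by
  filter_upwards [ae_ne_top_of_poisson (hξ.aemeasurable_occupationNumber hA)
    ENNReal.toReal_nonneg (hξ.poisson A hA hA')] with ω hω
  simpa [occupationNumber] using hω

/-- Independence of the occupation numbers for a finite family of disjoint sets, indexed by an
arbitrary countable type. -/
lemma IsREM.iIndepFun_of_countable (hξ : IsREM x ξ μ) {ι : Type*} [Countable ι] {A : ι → Set ℝ}
    (hA : ∀ i, MeasurableSet (A i)) (hd : Pairwise (fun i j => Disjoint (A i) (A j))) :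
    iIndepFun (fun i ω => occupationNumber (fun n => ξ n ω) (A i)) μ := by
  have := Encodable.ofCountable ι
  -- Transport the family to `ℕ` by an encoding, with the empty set at numbers that are no code.
  let A' : ℕ → Set ℝ := fun n => (Encodable.decode₂ ι n).elim ∅ A
  have h := hξ.indep A' (fun n => ?_) (fun m n hmn => ?_)
  · have h' := h.precomp (Encodable.encode_injective (α := ι))
    simpa [A', Function.comp_def, Encodable.encodek₂] using h'
  · simp only [A']
    cases Encodable.decode₂ ι n <;> simp [hA]
  · simp only [A']
    rcases hm : Encodable.decode₂ ι m with _ | i <;> rcases hn : Encodable.decode₂ ι n with _ | j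
    all_goals simp only [Option.elim, empty_disjoint, disjoint_empty]
    refine hd fun hij => hmn ?_
    rw [Encodable.mem_decode₂.1 hm |>.symm, Encodable.mem_decode₂.1 hn |>.symm, hij]

/-- The product formula of a Poisson process for a simple function. -/
lemma IsREM.lintegral_productFunctional_simpleFunc [IsProbabilityMeasure μ] (hξ : IsREM x ξ μ)
    (f : SimpleFunc ℝ ℝ≥0∞) (hf : ∀ t, f t ≤ 1) (hfin : ∫⁻ t, f t ∂remIntensity x ≠ ⊤) :
    ∫⁻ ω, productFunctional (fun t => 1 - f t) (fun n => ξ n ω) ∂μ =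
      ENNReal.ofReal (Real.exp (-(∫⁻ t, f t ∂remIntensity x).toReal)) := by
  classical
  set S := f.range.filter (· ≠ 0) with hS
  have hsum : ∫⁻ t, f t ∂remIntensity x = ∑ y ∈ S, y * remIntensity x (f ⁻¹' {y}) := by
    rw [SimpleFunc.lintegral_eq_lintegral, SimpleFunc.lintegral, hS, Finset.sum_filter_of_ne]
    rintro y - hy rfl
    simp at hy
  have hy1 : ∀ y ∈ S, y ≤ 1 := by
    intro y hy
    obtain ⟨t, rfl⟩ := SimpleFunc.mem_range.1 (Finset.mem_filter.1 hy).1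
    exact hf t
  -- The level sets of nonzero values have finite intensity, as `f` is integrable.
  have hμ : ∀ y ∈ S, remIntensity x (f ⁻¹' {y}) ≠ ⊤ := by
    intro y hy htop
    rw [hsum, ENNReal.sum_ne_top] at hfin
    refine hfin y hy ?_
    rw [htop, ENNReal.mul_top (Finset.mem_filter.1 hy).2]
  -- Almost surely only finitely many factors differ from one; collect them by the value of `f`.
  have hae : ∀ᵐ ω ∂μ, ∀ y ∈ S, {n | ξ n ω ∈ f ⁻¹' {y}}.Finite :=
    (Finset.eventually_all S).2 fun y hy => hξ.ae_finite (f.measurableSet_fiber y) (hμ y hy)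
  have hprod : ∀ᵐ ω ∂μ, productFunctional (fun t => 1 - f t) (fun n => ξ n ω) =
      ∏ y ∈ S, (1 - y) ^ (occupationNumber (fun n => ξ n ω) (f ⁻¹' {y})).toNat := by
    filter_upwards [hae] with ω hω
    have hfin' : {n | f (ξ n ω) ≠ 0}.Finite := by
      refine (Set.Finite.biUnion S.finite_toSet hω).subset fun n hn => ?_
      simp only [mem_iUnion]
      exact ⟨f (ξ n ω), by simpa [hS] using hn, by simp⟩
    rw [productFunctional_eq_prod (fun _ => tsub_le_self) hfin'.toFinset
      (fun k hk => by simp_all),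
      ← Finset.prod_fiberwise_of_maps_to (s := hfin'.toFinset) (t := S)
        (g := fun n => f (ξ n ω)) (fun n hn => by simpa [hS] using hn)]
    refine Finset.prod_congr rfl fun y hy => ?_
    rw [Finset.prod_congr rfl (g := fun _ => 1 - y)
      (fun n hn => by rw [(Finset.mem_filter.1 hn).2]), Finset.prod_const, occupationNumber]
    congr 1
    rw [← ENat.toNat_natCast (Finset.card _), ← Set.encard_coe_eq_coe_finsetCard]
    congr 2
    ext n
    have := (Finset.mem_filter.1 hy).2
    simp only [Finset.coe_filter, Finite.mem_toFinset, mem_ofPred_eq, mem_preimage,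
      mem_singleton_iff]
    constructor
    · exact fun h => h.2
    · exact fun h => ⟨h ▸ this, h⟩
  have hind : iIndepFun (fun (y : S) ω =>
      (1 - (y : ℝ≥0∞)) ^ (occupationNumber (fun n => ξ n ω) (f ⁻¹' {(y : ℝ≥0∞)})).toNat) μ :=
    (hξ.iIndepFun_of_countable (A := fun y : S => f ⁻¹' {(y : ℝ≥0∞)})
      (fun y => f.measurableSet_fiber y) fun y z hyz =>
        (disjoint_singleton.2 fun h => hyz (Subtype.ext h)).preimage f).comp
      (fun y (n : ℕ∞) => (1 - (y : ℝ≥0∞)) ^ n.toNat) fun _ => .of_discrete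
  simp_rw [← Finset.prod_coe_sort S] at hprod
  rw [lintegral_congr_ae hprod, lintegral_finset_prod_of_iIndepFun Finset.univ hind,
    Finset.prod_coe_sort S fun y => ∫⁻ ω,
      (1 - y) ^ (occupationNumber (fun n => ξ n ω) (f ⁻¹' {y})).toNat ∂μ]
  · rw [hsum, ENNReal.toReal_sum fun y hy => ENNReal.mul_ne_top
      (ne_top_of_le_ne_top ENNReal.one_ne_top (hy1 y hy)) (hμ y hy), ← Finset.sum_neg_distrib,
      Real.exp_sum, ENNReal.ofReal_prod_of_nonneg fun _ _ => by positivity]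
    refine Finset.prod_congr rfl fun y hy => ?_
    rw [ENNReal.toReal_mul]
    exact lintegral_one_sub_pow_of_poisson
      (hξ.aemeasurable_occupationNumber (f.measurableSet_fiber y)) ENNReal.toReal_nonneg
      (hξ.poisson _ (f.measurableSet_fiber y) (hμ y hy)) (hy1 y hy)
  · exact fun y => (Measurable.of_discrete (f := fun n : ℕ∞ => (1 - (y : ℝ≥0∞)) ^ n.toNat)
      ).comp_aemeasurable (hξ.aemeasurable_occupationNumber (f.measurableSet_fiber y))

end REM

/-! ### Independent marks and the intensity of the marked process -/

section Marks

variable {Ω : Type*} [MeasurableSpace Ω] {μ : Measure Ω} {x : ℝ} {ξ : ℕ → Ω → ℝ}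

open Filter in
/-- The product formula of a Poisson process: `E ∏ (1 - f(ξₙ)) = exp (-∫ f dρ)`. -/
lemma IsREM.lintegral_productFunctional [IsProbabilityMeasure μ] (hξ : IsREM x ξ μ)
    {f : ℝ → ℝ≥0∞} (hfm : Measurable f) (hf : ∀ t, f t ≤ 1)
    (hfin : ∫⁻ t, f t ∂remIntensity x ≠ ⊤) :
    ∫⁻ ω, productFunctional (fun t => 1 - f t) (fun n => ξ n ω) ∂μ =
      ENNReal.ofReal (Real.exp (-(∫⁻ t, f t ∂remIntensity x).toReal)) := by
  set F : ℕ → SimpleFunc ℝ ℝ≥0∞ := SimpleFunc.eapprox f with hF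
  have hFmono : ∀ t, Monotone (fun k => F k t) := fun t i j hij =>
    SimpleFunc.monotone_eapprox f hij t
  have hFle : ∀ k t, F k t ≤ f t := fun k t => by
    rw [← SimpleFunc.iSup_eapprox_apply hfm]
    exact le_iSup (fun n => F n t) k
  have hanti : ∀ w : ℕ → ℝ, Antitone (fun k => productFunctional (fun t => 1 - F k t) w) :=
    fun w i j hij => iInf_mono fun N => Finset.prod_le_prod' fun n _ =>
      tsub_le_tsub_left (hFmono _ hij) _
  have hlim : ∀ w : ℕ → ℝ, productFunctional (fun t => 1 - f t) w =
      ⨅ k, productFunctional (fun t => 1 - F k t) w := by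
    intro w
    simp only [productFunctional]
    rw [iInf_comm]
    congr with N
    refine tendsto_nhds_unique (f := fun k => ∏ n ∈ Finset.range N, (1 - F k (w n))) (l := atTop)
      ?_ ?_
    · refine ENNReal.tendsto_finsetProd_of_ne_top _ (fun n _ => ?_) fun n _ =>
        (tsub_le_self.trans_lt ENNReal.one_lt_top).ne
      exact ENNReal.Tendsto.sub tendsto_const_nhds (SimpleFunc.tendsto_eapprox hfm _)
        (.inl ENNReal.one_ne_top)
    · exact tendsto_atTop_iInf fun i j hij => Finset.prod_le_prod' fun n _ =>
        tsub_le_tsub_left (hFmono _ hij) _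
  have hξm := aemeasurable_pi_iff.2 hξ.aemeasurable
  have hmeas : ∀ k, AEMeasurable
      (fun ω => productFunctional (fun t => 1 - F k t) fun n => ξ n ω) μ := fun k =>
    (measurable_productFunctional (measurable_const.sub (F k).measurable)).comp_aemeasurable hξm
  simp_rw [hlim]
  rw [lintegral_iInf' hmeas (ae_of_all _ fun ω => hanti _)]
  · have hFfin : ∀ k, ∫⁻ t, F k t ∂remIntensity x ≠ ⊤ := fun k =>
      ne_top_of_le_ne_top hfin (lintegral_mono (hFle k))
    have hk := fun k => hξ.lintegral_productFunctional_simpleFunc (F k)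
      (fun t => (hFle k t).trans (hf t)) (hFfin k)
    refine tendsto_nhds_unique
      (tendsto_atTop_iInf fun i j hij => lintegral_mono fun ω => hanti _ hij) ?_
    simp_rw [hk]
    refine (ENNReal.continuous_ofReal.tendsto _).comp ((Real.continuous_exp.tendsto _).comp
      (Tendsto.neg ((ENNReal.tendsto_toReal hfin).comp ?_)))
    exact lintegral_tendsto_of_tendsto_of_monotone (fun k => (F k).measurable.aemeasurable)
      (ae_of_all _ hFmono) (ae_of_all _ fun t => SimpleFunc.tendsto_eapprox hfm t)
  · exact ne_top_of_le_ne_top (measure_ne_top μ univ)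
      ((lintegral_mono fun _ => productFunctional_le_one).trans_eq (by simp))

/-- Averaging a product over i.i.d. marks averages each factor. -/
lemma lintegral_productFunctional_marked (P : Measure (ℕ → ℝ)) [IsProbabilityMeasure P]
    (h : Measure ℝ) [IsProbabilityMeasure h] {φ : ℝ × ℝ → ℝ≥0∞} (hφm : Measurable φ)
    (hφ : ∀ z, φ z ≤ 1) :
    ∫⁻ p, productFunctional φ (fun n => (p.1 n, p.2 n)) ∂(P.prod (Measure.infinitePi fun _ => h)) =
      ∫⁻ a, productFunctional (fun t => ∫⁻ c, φ (t, c) ∂h) a ∂P := by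
  have hψ : Measurable fun t => ∫⁻ c, φ (t, c) ∂h := hφm.lintegral_prod_right'
  have hψ1 : ∀ t, ∫⁻ c, φ (t, c) ∂h ≤ 1 := fun t =>
    (lintegral_mono fun c => hφ (t, c)).trans_eq (by simp)
  have hm : ∀ N : ℕ, Measurable fun p : (ℕ → ℝ) × (ℕ → ℝ) =>
      ∏ n ∈ Finset.range N, φ (p.1 n, p.2 n) := fun N =>
    Finset.measurable_prod _ fun n _ => hφm.comp (by fun_prop)
  have hm' : ∀ N : ℕ, Measurable fun a : ℕ → ℝ =>
      ∏ n ∈ Finset.range N, ∫⁻ c, φ (a n, c) ∂h := fun N =>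
    Finset.measurable_prod _ fun n _ => hψ.comp (measurable_pi_apply n)
  simp only [productFunctional]
  rw [lintegral_iInf hm
    (fun i j hij p => antitone_prod_range (w := fun n => (p.1 n, p.2 n)) hφ hij) (by simp),
    lintegral_iInf hm' (fun i j hij a => antitone_prod_range (w := a) hψ1 hij) (by simp)]
  congr with N
  rw [lintegral_prod _ (hm N).aemeasurable]
  congr with a
  have hind := iIndepFun_infinitePi (P := fun _ : ℕ => h) (X := fun n c => φ (a n, c))
    fun n => hφm.comp (by fun_prop)
  rw [lintegral_finset_prod_of_iIndepFun _ hind fun n =>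
    (hφm.comp (by fun_prop)).aemeasurable]
  refine Finset.prod_congr rfl fun n _ => ?_
  exact (measurePreserving_eval_infinitePi (fun _ : ℕ => h) n).lintegral_comp
    (f := fun c => φ (a n, c)) (hφm.comp (by fun_prop))

/-- The product formula of the marked process: attaching i.i.d. marks of law `h` to the points of a
Poisson process with intensity `ρ` gives a Poisson process with intensity `ρ ⊗ h`. -/
lemma IsREM.lintegral_productFunctional_marked [IsProbabilityMeasure μ] (hξ : IsREM x ξ μ)
    (h : Measure ℝ) [IsProbabilityMeasure h] {φ : ℝ × ℝ → ℝ≥0∞} (hφm : Measurable φ)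
    (hφ : ∀ z, φ z ≤ 1) (hfin : ∫⁻ t, ∫⁻ c, 1 - φ (t, c) ∂h ∂remIntensity x ≠ ⊤) :
    ∫⁻ p, productFunctional φ (fun n => (p.1 n, p.2 n))
        ∂((μ.map fun ω n => ξ n ω).prod (Measure.infinitePi fun _ => h)) =
      ENNReal.ofReal
        (Real.exp (-(∫⁻ t, ∫⁻ c, 1 - φ (t, c) ∂h ∂remIntensity x).toReal)) := by
  have hξm := aemeasurable_pi_iff.2 hξ.aemeasurable
  have : IsProbabilityMeasure (μ.map fun ω n => ξ n ω) := Measure.isProbabilityMeasure_map hξm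
  have h1 : ∀ t, ∫⁻ c, 1 - φ (t, c) ∂h ≤ 1 := fun t =>
    (lintegral_mono fun c => tsub_le_self).trans_eq (by simp)
  have hψ : ∀ t, ∫⁻ c, φ (t, c) ∂h = 1 - ∫⁻ c, 1 - φ (t, c) ∂h := by
    intro t
    have hle : ∫⁻ c, φ (t, c) ∂h ≤ 1 := (lintegral_mono fun c => hφ (t, c)).trans_eq (by simp)
    have hφt : Measurable fun c => φ (t, c) := by fun_prop
    rw [lintegral_sub hφt (ne_top_of_le_ne_top ENNReal.one_ne_top hle)
      (ae_of_all _ fun c => hφ (t, c)), lintegral_one, measure_univ,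
      ENNReal.sub_sub_cancel ENNReal.one_ne_top hle]
  have hm : Measurable fun t => ∫⁻ c, 1 - φ (t, c) ∂h :=
    (measurable_const.sub hφm).lintegral_prod_right'
  rw [_root_.lintegral_productFunctional_marked _ h hφm hφ]
  simp_rw [hψ]
  have hF : Measurable (productFunctional fun t => 1 - ∫⁻ c, 1 - φ (t, c) ∂h) :=
    measurable_productFunctional (measurable_const.sub hm)
  rw [lintegral_map' hF.aemeasurable hξm]
  exact hξ.lintegral_productFunctional hm h1 hfin

end Marks

section Intensity

variable {x : ℝ} {g : Measure ℝ}

lemma remIntensity_Ioi_ne_top (hx : 0 < x) {q : ℝ} (hq : 0 < q) :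
    remIntensity x (Ioi q) ≠ ⊤ := by
  rw [remIntensity, withDensity_apply _ measurableSet_Ioi, Measure.restrict_restrict
    measurableSet_Ioi, inter_eq_left.2 (Ioi_subset_Ioi hq.le)]
  exact ((integrableOn_Ioi_rpow_of_lt (by linarith : -x - 1 < -1) hq).const_mul
    x).lintegral_lt_top.ne

lemma remIntensity_Iic : remIntensity x (Iic 0) = 0 := by
  rw [remIntensity, withDensity_apply _ measurableSet_Iic, Measure.restrict_restrict
    measurableSet_Iic, Iic_inter_Ioi, Ioc_self, Measure.restrict_empty, lintegral_zero_measure]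

/-- The intensity is homogeneous: dilation by `c` multiplies it by `cˣ`. -/
lemma lintegral_remIntensity_comp_mul {c : ℝ} (hc : 0 < c) {v : ℝ → ℝ≥0∞} (hv : Measurable v) :
    ∫⁻ t, v (c * t) ∂remIntensity x = ENNReal.ofReal (c ^ x) * ∫⁻ t, v t ∂remIntensity x := by
  have hd : Measurable fun t : ℝ => ENNReal.ofReal (x * t ^ (-x - 1)) := by fun_prop
  simp only [remIntensity]
  rw [lintegral_withDensity_eq_lintegral_mul _ hd (by fun_prop),
    lintegral_withDensity_eq_lintegral_mul _ hd hv, ← lintegral_const_mul _ (hd.mul hv),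
    ← lintegral_indicator measurableSet_Ioi, ← lintegral_indicator measurableSet_Ioi]
  have hm := ((hd.mul hv).const_mul (ENNReal.ofReal (c ^ x))).indicator
    (measurableSet_Ioi (a := (0 : ℝ)))
  conv_rhs => rw [← Real.smul_map_volume_mul_left hc.ne', lintegral_smul_measure,
    lintegral_map hm (by fun_prop), smul_eq_mul,
    ← lintegral_const_mul _ (hm.fun_comp (measurable_const_mul c))]
  congr with t
  by_cases ht : 0 < t
  · have hct : 0 < c * t := mul_pos hc ht
    rw [indicator_of_mem (mem_Ioi.2 ht), indicator_of_mem (mem_Ioi.2 hct)]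
    simp only [Pi.mul_apply]
    rw [← mul_assoc, ← mul_assoc, ← ENNReal.ofReal_mul (abs_nonneg _), ← ENNReal.ofReal_mul
      (by positivity), abs_of_pos hc]
    congr 2
    rw [Real.mul_rpow hc.le ht.le, Real.rpow_sub_one hc.ne', Real.rpow_neg hc.le]
    field_simp
  · have hct : ¬ 0 < c * t := fun h => ht (pos_of_mul_pos_right h hc.le)
    rw [indicator_of_notMem (by simpa using ht), indicator_of_notMem (by simpa using hct), mul_zero]

lemma isProbabilityMeasure_tiltedLaw (hg_nonneg : ∀ᵐ c ∂g, 0 ≤ c)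
    (hg_moment : Integrable (fun c : ℝ => c ^ x) g) (hg_pos : 0 < ∫ c, c ^ x ∂g) :
    IsProbabilityMeasure (tiltedLaw x g) := by
  constructor
  rw [tiltedLaw, withDensity_apply _ .univ, Measure.restrict_univ,
    ← ofReal_integral_eq_lintegral_ofReal (hg_moment.div_const _), integral_div,
    div_self hg_pos.ne', ENNReal.ofReal_one]
  filter_upwards [hg_nonneg] with c hc
  exact div_nonneg (Real.rpow_nonneg hc x) hg_pos.le

/-- Under `(t, c) ↦ (c t, c)`, the measure `ρ ⊗ g` on pairs with `c t ≠ 0` becomes the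
image of `ρ ⊗ g̃` under `(t, c) ↦ (K t, c)`, where `g̃` is the tilted law. -/
lemma lintegral_remIntensity_mul_mark [SFinite g] (hx : 0 < x) (hg_nonneg : ∀ᵐ c ∂g, 0 ≤ c)
    (hg_moment : Integrable (fun c : ℝ => c ^ x) g) (hg_pos : 0 < ∫ c, c ^ x ∂g)
    {u : ℝ × ℝ → ℝ≥0∞} (hu : Measurable u) (hu0 : ∀ c, u (0, c) = 0) :
    ∫⁻ t, ∫⁻ c, u (c * t, c) ∂g ∂remIntensity x =
      ∫⁻ t, ∫⁻ c, u ((∫ c, c ^ x ∂g) ^ (1 / x) * t, c) ∂tiltedLaw x g ∂remIntensity x := by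
  have := isProbabilityMeasure_tiltedLaw hg_nonneg hg_moment hg_pos
  have hs : SFinite (remIntensity x) := by unfold remIntensity; infer_instance
  set M := ∫ c, c ^ x ∂g with hM
  have hK : 0 < M ^ (1 / x) := Real.rpow_pos_of_pos hg_pos _
  have hKx : (M ^ (1 / x)) ^ x = M := by
    rw [← Real.rpow_mul hg_pos.le, one_div_mul_cancel hx.ne', Real.rpow_one]
  have hI : Measurable fun c => ∫⁻ t, u (t, c) ∂remIntensity x := hu.lintegral_prod_left'
  rw [lintegral_lintegral_swap (f := fun t c => u (c * t, c)) (by fun_prop),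
    lintegral_lintegral_swap (f := fun t c => u (M ^ (1 / x) * t, c)) (by fun_prop)]
  have hR : ∀ c, ∫⁻ t, u (M ^ (1 / x) * t, c) ∂remIntensity x =
      ENNReal.ofReal M * ∫⁻ t, u (t, c) ∂remIntensity x := fun c => by
    rw [lintegral_remIntensity_comp_mul hK (v := fun t => u (t, c)) (hu.comp (by fun_prop)), hKx]
  rw [lintegral_congr hR, tiltedLaw,
    lintegral_withDensity_eq_lintegral_mul _ (by fun_prop) (hI.const_mul _)]
  refine lintegral_congr_ae ?_
  filter_upwards [hg_nonneg] with c hc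
  rw [Pi.mul_apply, ← mul_assoc, ← ENNReal.ofReal_mul (by positivity),
    div_mul_cancel₀ _ hg_pos.ne']
  rcases hc.eq_or_lt with rfl | hc
  -- A mark zero puts its points at position zero, where `u` vanishes; also `0ˣ = 0`.
  · simp [hu0, Real.zero_rpow hx.ne']
  · exact lintegral_remIntensity_comp_mul hc (v := fun t => u (t, c)) (hu.comp (by fun_prop))

end Intensity

/-! ### Counts determine descending configurations -/

section Determination

/-- Two finite measures on a countable power of `[0, 1]` with the same moments are equal. -/
lemma ext_of_moments {ι : Type*} [Countable ι] {P P' : Measure (ι → unitInterval)}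
    [IsFiniteMeasure P] [IsFiniteMeasure P']
    (h : ∀ l : List ι, ∫ z, (l.map fun i => (z i : ℝ)).prod ∂P =
      ∫ z, (l.map fun i => (z i : ℝ)).prod ∂P') : P = P' := by
  let coord : ι → BoundedContinuousFunction (ι → unitInterval) ℝ := fun i =>
    BoundedContinuousFunction.mkOfCompact
      ⟨fun z => (z i : ℝ), continuous_subtype_val.comp (continuous_apply i)⟩
  have hcoord : ∀ i z, coord i z = z i := fun _ _ => rfl
  have hmem : ∀ f, f ∈ StarAlgebra.adjoin ℝ (range coord) ↔
      f ∈ Algebra.adjoin ℝ (range coord) := by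
    intro f
    rw [← StarSubalgebra.mem_toSubalgebra, StarAlgebra.adjoin_toSubalgebra]
    have : star (range coord) = range coord := by
      ext f
      rw [Set.mem_star, show star f = f from by ext; simp]
    rw [this, union_self]
  refine ext_of_forall_mem_subalgebra_integral_eq_of_polish (𝕜 := ℝ)
    (A := StarAlgebra.adjoin ℝ (range coord)) ?_ fun f hf => ?_
  · intro z z' hzz'
    obtain ⟨i, hi⟩ := Function.ne_iff.1 hzz'
    refine ⟨_, ⟨_, ⟨coord i, StarAlgebra.subset_adjoin _ _ ⟨i, rfl⟩, rfl⟩, rfl⟩, ?_⟩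
    exact fun h => hi (Subtype.ext h)
  · rw [hmem, ← Subalgebra.mem_toSubmodule, Algebra.adjoin_eq_span] at hf
    induction hf using Submodule.span_induction with
    | zero => simp
    | add f g _ _ hf hg =>
      simp only [BoundedContinuousFunction.coe_add, Pi.add_apply]
      rw [integral_add (f.integrable P) (g.integrable P),
        integral_add (f.integrable P') (g.integrable P'), hf, hg]
    | smul r f _ hf =>
      simp only [BoundedContinuousFunction.coe_smul]
      rw [integral_smul, integral_smul, hf]
    | mem f hf =>
      obtain ⟨l, hl, rfl⟩ := Submonoid.exists_list_of_mem_closure hf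
      obtain ⟨l', rfl⟩ : ∃ l' : List ι, l'.map coord = l := by
        have := Set.range_list_map coord
        exact (this ▸ hl : l ∈ range (List.map coord))
      have hprod : ∀ z, (l'.map coord).prod z = (l'.map fun i => (z i : ℝ)).prod := by
        intro z
        clear hl hf
        induction l' with
        | nil => simp
        | cons i l ih => simp [ih, hcoord]
      simp_rw [hprod]
      exact h l'

/-- Configurations of marked points, listed with strictly decreasing positive positions that tend to
zero. -/
def descendingConfigurations : Set (ℕ → ℝ × ℝ) :=
  {w | StrictAnti (fun n => (w n).1) ∧ (∀ n, 0 < (w n).1) ∧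
    ∀ j : ℕ, ∃ n, (w n).1 ≤ 1 / ((j : ℝ) + 1)}

lemma measurableSet_descendingConfigurations : MeasurableSet descendingConfigurations := by
  have h : descendingConfigurations = (⋂ n, {w | (w (n + 1)).1 < (w n).1}) ∩
      ((⋂ n, {w | 0 < (w n).1}) ∩ ⋂ j : ℕ, ⋃ n, {w | (w n).1 ≤ 1 / ((j : ℝ) + 1)}) := by
    ext w
    simp only [descendingConfigurations, mem_ofPred_eq, mem_inter_iff, mem_iInter, mem_iUnion]
    exact and_congr_left fun _ => ⟨fun h n => h n.lt_succ_self,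
      fun h => strictAnti_nat_of_succ_lt h⟩
  rw [h]
  refine .inter (.iInter fun n => measurableSet_lt (by fun_prop) (by fun_prop)) (.inter
    (.iInter fun n => measurableSet_lt (by fun_prop) (by fun_prop))
    (.iInter fun j => .iUnion fun n => measurableSet_le (by fun_prop) (by fun_prop)))

/-- A countable family of Borel sets of marked points, each bounded away from position zero. For a
fixed first index the sets form, up to restriction, a π-system that generates the Borel sets. -/
def testSet (i : ℕ × Finset ℕ) : Set (ℝ × ℝ) :=
  {z | 1 / ((i.1 : ℝ) + 1) < z.1} ∩ ⋂ k ∈ i.2, MeasurableSpace.natGeneratingSequence (ℝ × ℝ) k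

lemma measurableSet_testSet (i : ℕ × Finset ℕ) : MeasurableSet (testSet i) :=
  (measurableSet_lt measurable_const measurable_fst).inter
    (.biInter i.2.countable_toSet fun k _ => MeasurableSpace.measurableSet_natGeneratingSequence k)

/-- The values `∏ₙ 2^{-1(wₙ ∈ B)} = 2^{-#(points in B)}` for all test sets `B`. -/
noncomputable def countVector (w : ℕ → ℝ × ℝ) (i : ℕ × Finset ℕ) : unitInterval :=
  ⟨(productFunctional (halfOn (testSet i)) w).toReal, ENNReal.toReal_nonneg,
    ENNReal.toReal_le_of_le_ofReal zero_le_one (by simpa using productFunctional_le_one)⟩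

lemma measurable_countVector : Measurable countVector :=
  measurable_pi_iff.2 fun i => Measurable.subtype_mk
    (measurable_productFunctional (measurable_halfOn (measurableSet_testSet i))).ennreal_toReal

lemma countVector_eq_iff {w v : ℕ → ℝ × ℝ} : countVector w = countVector v ↔
    ∀ i, productFunctional (halfOn (testSet i)) w = productFunctional (halfOn (testSet i)) v := by
  simp only [funext_iff, countVector]
  exact forall_congr' fun i => Subtype.mk_eq_mk.trans <|
    ENNReal.toReal_eq_toReal_iff' productFunctional_ne_top productFunctional_ne_top

/-- The counts in the test sets determine how often each point with positive position occurs,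
provided that they are the counts of a locally finite configuration. -/
lemma encard_preimage_singleton_eq {w d : ℕ → ℝ × ℝ} (hd : d ∈ descendingConfigurations)
    (h : countVector w = countVector d) {z : ℝ × ℝ} (hz : 0 < z.1) :
    (w ⁻¹' {z}).encard = (d ⁻¹' {z}).encard := by
  obtain ⟨j, hj⟩ := exists_nat_one_div_lt hz
  -- Compare the counting measures of `w` and `d` on a half-plane that contains `z`.
  set U : Set (ℝ × ℝ) := {z | 1 / ((j : ℝ) + 1) < z.1} with hU
  have hUm : MeasurableSet U := measurableSet_lt measurable_const measurable_fst
  set C : Finset ℕ → Set (ℝ × ℝ) := fun s =>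
    ⋂ k ∈ s, MeasurableSpace.natGeneratingSequence (ℝ × ℝ) k with hC
  have hCm : ∀ s, MeasurableSet (C s) := fun s =>
    .biInter s.countable_toSet fun k _ => MeasurableSpace.measurableSet_natGeneratingSequence k
  have hcount : ∀ (v : ℕ → ℝ × ℝ) {B : Set (ℝ × ℝ)}, MeasurableSet B →
      (Measure.count.map v).restrict U B = ((v ⁻¹' (U ∩ B)).encard : ℝ≥0∞) := by
    intro v B hB
    rw [Measure.restrict_apply hB, inter_comm,
      Measure.map_apply measurable_from_nat (hUm.inter hB), Measure.count_apply .of_discrete]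
  have hdfin : (d ⁻¹' U).Finite := by
    obtain ⟨n, hn⟩ := hd.2.2 j
    refine (finite_lt_nat n).subset fun m hm => ?_
    by_contra hmn
    exact absurd (lt_of_lt_of_le hm (hd.1.antitone (not_lt.1 hmn))) (not_lt.2 hn)
  have hfin : IsFiniteMeasure ((Measure.count.map d).restrict U) := by
    constructor
    rw [hcount d .univ, inter_univ, ← hdfin.cast_ncard_eq]
    simp
  have heq : ∀ s, (Measure.count.map d).restrict U (C s) =
      (Measure.count.map w).restrict U (C s) := by
    intro s
    rw [hcount d (hCm s), hcount w (hCm s)]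
    exact congrArg _ (encard_preimage_eq_of_productFunctional_halfOn_eq
      (countVector_eq_iff.1 h (j, s))).symm
  have hm : (Measure.count.map d).restrict U = (Measure.count.map w).restrict U := by
    refine ext_of_generate_finite (range C) (le_antisymm ?_ ?_) ?_ ?_ ?_
    · rw [← MeasurableSpace.generateFrom_natGeneratingSequence (ℝ × ℝ)]
      refine MeasurableSpace.generateFrom_mono ?_
      rintro _ ⟨k, rfl⟩
      exact ⟨{k}, by simp [hC]⟩
    · refine MeasurableSpace.generateFrom_le ?_
      rintro _ ⟨s, rfl⟩
      exact hCm s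
    · rintro _ ⟨s, rfl⟩ _ ⟨t, rfl⟩ -
      exact ⟨s ∪ t, by ext z; simp [hC, or_imp, forall_and]⟩
    · rintro _ ⟨s, rfl⟩
      exact heq s
    · simpa [hC] using heq ∅
  have hz' := congrArg (fun m : Measure (ℝ × ℝ) => m {z}) hm
  simp only [hcount _ (measurableSet_singleton z)] at hz'
  have hzU : U ∩ {z} = {z} := inter_eq_right.2 (singleton_subset_iff.2 hj)
  rw [hzU] at hz'
  exact (ENat.toENNReal_inj.1 hz').symm

/-- A configuration with the same counts as a descending one is a rearrangement of it, up to points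
at nonpositive positions. In particular it has no ties. -/
lemma exists_relabelling {w d : ℕ → ℝ × ℝ} (hd : d ∈ descendingConfigurations)
    (h : countVector w = countVector d) :
    ∃ σ : ℕ → ℕ, σ.Injective ∧ (∀ n, w (σ n) = d n) ∧ ∀ k, 0 < (w k).1 → k ∈ range σ := by
  have hinj : d.Injective := fun m n hmn => hd.1.injective (congrArg Prod.fst hmn)
  have h1 : ∀ n, ∃ k, w ⁻¹' {d n} = {k} := fun n => by
    rw [← Set.encard_eq_one, encard_preimage_singleton_eq hd h (hd.2.1 n), Set.encard_eq_one]
    exact ⟨n, by ext m; simp [hinj.eq_iff]⟩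
  choose σ hσ using h1
  have hwσ : ∀ n, w (σ n) = d n := fun n => by
    have : σ n ∈ w ⁻¹' {d n} := by rw [hσ]; rfl
    exact this
  refine ⟨σ, fun m n hmn => hinj (by rw [← hwσ, ← hwσ, hmn]), hwσ, fun k hk => ?_⟩
  have hne : (d ⁻¹' {w k}).Nonempty := by
    rw [← Set.encard_ne_zero, ← encard_preimage_singleton_eq hd h hk, Set.encard_ne_zero]
    exact ⟨k, rfl⟩
  obtain ⟨n, hn⟩ := hne
  refine ⟨n, ?_⟩
  have : k ∈ w ⁻¹' {d n} := hn.symm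
  rw [hσ] at this
  exact this.symm

lemma injOn_countVector : InjOn countVector descendingConfigurations := by
  intro w hw d hd h
  obtain ⟨σ, -, hσ, hrange⟩ := exists_relabelling hd h
  have hmono : StrictMono σ := fun m n hmn => by
    rw [← hw.1.lt_iff_gt]
    simpa only [hσ] using hd.1 hmn
  -- A strictly increasing surjection of `ℕ` is the identity.
  have hid : σ = id := (hmono.range_inj strictMono_id).1 <| by
    rw [range_id, eq_univ_iff_forall]
    exact fun k => hrange k (hw.2.1 k)
  ext1 n
  simpa [hid] using hσ n

/-- Descending configurations can be recovered measurably from their counts (the Lusin–Souslin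
theorem). -/
lemma exists_measurable_leftInvOn_countVector :
    ∃ R : (ℕ × Finset ℕ → unitInterval) → ℕ → ℝ × ℝ, Measurable R ∧
      ∀ d ∈ descendingConfigurations, R (countVector d) = d := by
  have := measurableSet_descendingConfigurations.standardBorel
  have he : MeasurableEmbedding fun d : descendingConfigurations => countVector d :=
    (measurable_countVector.comp measurable_subtype_coe).measurableEmbedding
      fun v w h => Subtype.ext (injOn_countVector v.2 w.2 h)
  obtain ⟨R, hR, hR'⟩ := he.exists_measurable_extend measurable_subtype_coe fun _ => ⟨0⟩
  exact ⟨R, hR, fun d hd => congrFun hR' ⟨d, hd⟩⟩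

lemma measurableSet_image_countVector :
    MeasurableSet (countVector '' descendingConfigurations) :=
  measurableSet_descendingConfigurations.image_of_measurable_injOn measurable_countVector
    injOn_countVector

lemma measurable_list_prod_halfOn (l : List (ℕ × Finset ℕ)) :
    Measurable fun z => (l.map fun i => halfOn (testSet i) z).prod := by
  induction l with
  | nil => simp
  | cons i l ih =>
    simp only [List.map_cons, List.prod_cons]
    exact (measurable_halfOn (measurableSet_testSet i)).mul ih

/-- The law of the counts is determined by the expectations of the product functionals, since these
are the joint moments of the coordinates of `countVector`. -/
lemma map_countVector_eq {P P' : Measure (ℕ → ℝ × ℝ)} [IsProbabilityMeasure P]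
    [IsProbabilityMeasure P']
    (h : ∀ l : List (ℕ × Finset ℕ),
      ∫⁻ w, productFunctional (fun z => (l.map fun i => halfOn (testSet i) z).prod) w ∂P =
        ∫⁻ w, productFunctional (fun z => (l.map fun i => halfOn (testSet i) z).prod) w ∂P') :
    P.map countVector = P'.map countVector := by
  have := Measure.isProbabilityMeasure_map (μ := P) measurable_countVector.aemeasurable
  have := Measure.isProbabilityMeasure_map (μ := P') measurable_countVector.aemeasurable
  have key : ∀ (l : List (ℕ × Finset ℕ)) (Q : Measure (ℕ → ℝ × ℝ)),
      ∫ z, (l.map fun i => (z i : ℝ)).prod ∂(Q.map countVector) = (∫⁻ w, productFunctional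
        (fun z => (l.map fun i => halfOn (testSet i) z).prod) w ∂Q).toReal := by
    intro l Q
    have hm : Measurable fun z : ℕ × Finset ℕ → unitInterval =>
        (l.map fun i => (z i : ℝ)).prod := by
      induction l with
      | nil => simp
      | cons i l ih =>
        simp only [List.map_cons, List.prod_cons]
        exact (measurable_subtype_coe.comp (measurable_pi_apply i)).mul ih
    have hf := measurable_list_prod_halfOn l
    rw [integral_map measurable_countVector.aemeasurable hm.aestronglyMeasurable,
      ← integral_toReal (measurable_productFunctional hf).aemeasurable
        (ae_of_all _ fun w => productFunctional_ne_top.lt_top)]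
    congr with w
    rw [productFunctional_list_prod fun i => halfOn_le_one _]
    simp only [countVector]
    clear hm hf
    induction l with
    | nil => simp
    | cons i l ih => simp [ih]
  refine ext_of_moments fun l => ?_
  rw [key, key, h]

/-- Finitely many test sets are jointly bounded away from position zero. -/
lemma exists_pos_forall_list_prod_halfOn_eq_one (l : List (ℕ × Finset ℕ)) :
    ∃ q : ℝ, 0 < q ∧ ∀ z : ℝ × ℝ, z.1 ≤ q → (l.map fun i => halfOn (testSet i) z).prod = 1 := by
  induction l with
  | nil => exact ⟨1, one_pos, by simp⟩
  | cons i l ih =>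
    obtain ⟨q, hq, h⟩ := ih
    refine ⟨min q (1 / ((i.1 : ℝ) + 1)), lt_min hq (by positivity), fun z hz => ?_⟩
    rw [List.map_cons, List.prod_cons, h z (hz.trans (min_le_left _ _)), mul_one]
    exact halfOn_of_notMem fun hz' => absurd hz'.1 (not_lt.2 (hz.trans (min_le_right _ _)))

/-- A strictly decreasing sequence is determined by its range, and `w` is injective on the range of
a descending relabelling. -/
lemma IsDescendingRelabelling.unique {w : ℕ → ℝ} {σ τ : ℕ → ℕ}
    (hσ : IsDescendingRelabelling w σ) (hτ : IsDescendingRelabelling w τ) : σ = τ := by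
  have hr : range σ = range τ := by
    rw [← image_univ, ← image_univ, hσ.bijOn.image_eq, hτ.bijOn.image_eq]
  have h : (fun n => w (σ n)) = fun n => w (τ n) :=
    congrArg (OrderDual.ofDual ∘ ·) ((StrictMono.range_inj (γ := ℝᵒᵈ)
      (f := fun n => OrderDual.toDual (w (σ n))) (g := fun n => OrderDual.toDual (w (τ n)))
      hσ.strictAnti.dual_right hτ.strictAnti.dual_right).1
      (by
        have := congrArg (image fun k => OrderDual.toDual (w k)) hr
        rwa [← range_comp, ← range_comp] at this))
  ext1 n
  obtain ⟨m, hm⟩ : σ n ∈ range τ := hr ▸ mem_range_self n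
  have : m = n := hτ.strictAnti.injective <| by
    have := congrFun h n
    simp_all
  rw [← hm, this]

end Determination

/-! ### The law of the relabelled process -/

section Relabelling

variable {Ω : Type*} [MeasurableSpace Ω] {μ : Measure Ω} {x : ℝ} {g : Measure ℝ}
  {ξ γ : ℕ → Ω → ℝ}

/-- The half-line `(-∞, 0]` has intensity zero, hence almost surely contains no point. -/
lemma IsREM.ae_pos [IsProbabilityMeasure μ] (hξ : IsREM x ξ μ) :
    ∀ᵐ ω ∂μ, ∀ n, 0 < ξ n ω := by
  have h := hξ.poisson (Iic 0) measurableSet_Iic (by simp [remIntensity_Iic]) 0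
  simp only [remIntensity_Iic, Nat.cast_zero, ENNReal.toReal_zero, pow_zero, Nat.factorial_zero,
    Nat.cast_one, div_one, neg_zero, Real.exp_zero, mul_one, ENNReal.ofReal_one] at h
  have hnull : NullMeasurableSet
      {ω | occupationNumber (fun n => ξ n ω) (Iic 0) = 0} μ :=
    (hξ.aemeasurable_occupationNumber measurableSet_Iic).nullMeasurable
      (measurableSet_singleton (0 : ℕ∞))
  have h' : ∀ᵐ ω ∂μ, occupationNumber (fun n => ξ n ω) (Iic 0) = 0 :=
    (prob_compl_eq_zero_iff₀ hnull).2 h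
  filter_upwards [h'] with ω hω n
  by_contra hn
  rw [occupationNumber, Set.encard_eq_zero] at hω
  have : n ∈ {n | ξ n ω ∈ Iic 0} := not_lt.1 hn
  rw [hω] at this
  exact this

lemma IsREM.ae_exists_le [IsProbabilityMeasure μ] (hx : 0 < x) (hξ : IsREM x ξ μ) :
    ∀ᵐ ω ∂μ, ∀ q : ℚ, 0 < q → ∃ n, ξ n ω ≤ q := by
  rw [ae_all_iff]
  intro q
  by_cases hq : 0 < q
  · have hq' : (0 : ℝ) < q := by exact_mod_cast hq
    filter_upwards [hξ.ae_finite measurableSet_Ioi (remIntensity_Ioi_ne_top hx hq')] with ω hω _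
    obtain ⟨n, hn⟩ := hω.exists_notMem
    exact ⟨n, not_lt.1 hn⟩
  · exact ae_of_all _ fun ω h => absurd h hq

/-- The configuration with the points `Kξₙ` and independent marks is almost surely in descending
order. -/
lemma IsREM.ae_mem_descendingConfigurations [IsProbabilityMeasure μ] (hx : 0 < x)
    (hξ : IsREM x ξ μ) (hξ_desc : ∀ᵐ ω ∂μ, StrictAnti (fun n => ξ n ω)) {K : ℝ} (hK : 0 < K)
    (c : ℕ → ℝ) :
    ∀ᵐ ω ∂μ, (fun n => (K * ξ n ω, c n)) ∈ descendingConfigurations := by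
  filter_upwards [hξ_desc, hξ.ae_pos, hξ.ae_exists_le hx] with ω h1 h2 h3
  refine ⟨fun m n hmn => mul_lt_mul_of_pos_left (h1 hmn) hK, fun n => mul_pos hK (h2 n),
    fun j => ?_⟩
  obtain ⟨q, hq0, hq⟩ := exists_rat_btwn (show (0 : ℝ) < 1 / ((j : ℝ) + 1) / K by positivity)
  obtain ⟨n, hn⟩ := h3 q (by exact_mod_cast hq0)
  refine ⟨n, ?_⟩
  have := (lt_div_iff₀' hK).1 (hn.trans_lt hq)
  exact this.le

/-- The law of the list of the points `Kξₙ` with independent i.i.d. marks of the tilted law,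
where `K = ⟨γˣ⟩^{1/x}`. -/
noncomputable def markedLaw (x : ℝ) (g : Measure ℝ) (ξ : ℕ → Ω → ℝ) (μ : Measure Ω) :
    Measure (ℕ → ℝ × ℝ) :=
  ((μ.map fun ω n => ξ n ω).prod (Measure.infinitePi fun _ => tiltedLaw x g)).map
    fun p n => ((∫ c, c ^ x ∂g) ^ (1 / x) * p.1 n, p.2 n)

/-- The marked processes `(γₙξₙ, γₙ)` and `(Kξₙ, γ'ₙ)`, with `γ'ₙ` i.i.d. of the tilted law and
independent of `ξ`, have the same product functionals, since both are Poisson processes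
with the same intensity. -/
lemma map_countVector_eq_markedLaw [IsProbabilityMeasure μ] [IsProbabilityMeasure g] (hx : 0 < x)
    (hg_nonneg : ∀ᵐ c ∂g, 0 ≤ c) (hg_moment : Integrable (fun c : ℝ => c ^ x) g)
    (hg_pos : 0 < ∫ c, c ^ x ∂g) (hξ : IsREM x ξ μ)
    (hγ_law : ∀ n, HasLaw (γ n) g μ) (hγ_indep : iIndepFun γ μ)
    (hξγ : IndepFun (fun ω n => ξ n ω) (fun ω n => γ n ω) μ) :
    (μ.map fun ω n => (γ n ω * ξ n ω, γ n ω)).map countVector =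
      (markedLaw x g ξ μ).map countVector := by
  have htilt := isProbabilityMeasure_tiltedLaw hg_nonneg hg_moment hg_pos
  have hξm := aemeasurable_pi_iff.2 hξ.aemeasurable
  have hγm := aemeasurable_pi_iff.2 fun n => (hγ_law n).aemeasurable
  have hP : IsProbabilityMeasure (μ.map fun ω n => ξ n ω) := Measure.isProbabilityMeasure_map hξm
  have hjoint : μ.map (fun ω => ((fun n => ξ n ω), fun n => γ n ω)) =
      (μ.map fun ω n => ξ n ω).prod (Measure.infinitePi fun _ => g) := by
    rw [hξγ.map_prod_eq_prod_map_map hξm hγm,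
      hγ_indep.map_fun_eq_infinitePi_map₀' fun n => (hγ_law n).aemeasurable]
    simp_rw [(hγ_law _).map_eq]
  have hraw : (μ.map fun ω n => (γ n ω * ξ n ω, γ n ω)) =
      ((μ.map fun ω n => ξ n ω).prod (Measure.infinitePi fun _ => g)).map
        fun p n => (p.2 n * p.1 n, p.2 n) := by
    rw [← hjoint, AEMeasurable.map_map_of_aemeasurable (by fun_prop) (hξm.prodMk hγm)]
    rfl
  have hm1 : Measurable fun (p : (ℕ → ℝ) × (ℕ → ℝ)) n => (p.2 n * p.1 n, p.2 n) := by fun_prop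
  have hm2 : Measurable fun (p : (ℕ → ℝ) × (ℕ → ℝ)) n =>
      ((∫ c, c ^ x ∂g) ^ (1 / x) * p.1 n, p.2 n) := by fun_prop
  rw [hraw, markedLaw]
  have := Measure.isProbabilityMeasure_map (μ := (μ.map fun ω n => ξ n ω).prod
    (Measure.infinitePi fun _ => g)) hm1.aemeasurable
  have := Measure.isProbabilityMeasure_map (μ := (μ.map fun ω n => ξ n ω).prod
    (Measure.infinitePi fun _ => tiltedLaw x g)) hm2.aemeasurable
  refine map_countVector_eq fun l => ?_
  set φ : ℝ × ℝ → ℝ≥0∞ := fun z => (l.map fun i => halfOn (testSet i) z).prod with hφ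
  have hφ1 : ∀ z, φ z ≤ 1 := fun z => list_prod_map_le_one (fun i => halfOn_le_one _ z) l
  have hφm : Measurable φ := measurable_list_prod_halfOn l
  obtain ⟨q, hq, hφq⟩ := exists_pos_forall_list_prod_halfOn_eq_one l
  have hK : 0 < (∫ c, c ^ x ∂g) ^ (1 / x) := Real.rpow_pos_of_pos hg_pos _
  set K := (∫ c, c ^ x ∂g) ^ (1 / x) with hKdef
  -- Both product formulas have the same exponent.
  have hint := lintegral_remIntensity_mul_mark hx hg_nonneg hg_moment hg_pos
    (u := fun z => 1 - φ z) (measurable_const.sub hφm)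
    (fun c => by simp only [hφq (0, c) hq.le, hφ, tsub_self])
  have hfin : ∫⁻ t, ∫⁻ c, 1 - φ (K * t, c) ∂tiltedLaw x g ∂remIntensity x ≠ ⊤ := by
    refine ne_top_of_le_ne_top (remIntensity_Ioi_ne_top hx (div_pos hq hK)) ?_
    rw [← lintegral_indicator_one measurableSet_Ioi]
    refine lintegral_mono fun t => ?_
    by_cases ht : t ∈ Ioi (q / K)
    · rw [indicator_of_mem ht]
      exact (lintegral_mono fun c => tsub_le_self).trans_eq (by simp)
    · have ht' : K * t ≤ q := by
        rw [mem_Ioi, not_lt, le_div_iff₀' hK] at ht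
        exact ht
      have h0 : ∀ c, φ (K * t, c) = 1 := fun c => hφq (K * t, c) ht'
      simp [h0]
  have hF := measurable_productFunctional hφm
  rw [lintegral_map hF hm1, lintegral_map hF hm2]
  refine (hξ.lintegral_productFunctional_marked g (φ := fun z => φ (z.2 * z.1, z.2))
    (hφm.comp (by fun_prop)) (fun z => hφ1 _) (by rw [hint]; exact hfin)).trans ?_
  refine Eq.trans ?_ (hξ.lintegral_productFunctional_marked (tiltedLaw x g)
    (φ := fun z => φ (K * z.1, z.2)) (hφm.comp (by fun_prop)) (fun z => hφ1 _) hfin).symm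
  rw [hint]

/-- Almost surely the configuration `(γₙξₙ, γₙ)` can be relabelled into a descending one. -/
lemma ae_exists_descending [IsProbabilityMeasure μ] [IsProbabilityMeasure g] (hx : 0 < x)
    (hg_nonneg : ∀ᵐ c ∂g, 0 ≤ c) (hg_moment : Integrable (fun c : ℝ => c ^ x) g)
    (hg_pos : 0 < ∫ c, c ^ x ∂g) (hξ : IsREM x ξ μ)
    (hξ_desc : ∀ᵐ ω ∂μ, StrictAnti (fun n => ξ n ω))
    (hγ_law : ∀ n, HasLaw (γ n) g μ) (hγ_indep : iIndepFun γ μ)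
    (hξγ : IndepFun (fun ω n => ξ n ω) (fun ω n => γ n ω) μ) :
    (∀ᵐ w ∂markedLaw x g ξ μ, w ∈ descendingConfigurations) ∧
    ∀ᵐ ω ∂μ, ∃ d ∈ descendingConfigurations,
      countVector (fun n => (γ n ω * ξ n ω, γ n ω)) = countVector d ∧
      ∃ σ, IsDescendingRelabelling (fun n => γ n ω * ξ n ω) σ ∧
        (fun n => (γ (σ n) ω * ξ (σ n) ω, γ (σ n) ω)) = d := by
  have htilt := isProbabilityMeasure_tiltedLaw hg_nonneg hg_moment hg_pos
  have hξm := aemeasurable_pi_iff.2 hξ.aemeasurable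
  have hP : IsProbabilityMeasure (μ.map fun ω n => ξ n ω) := Measure.isProbabilityMeasure_map hξm
  have hK : 0 < (∫ c, c ^ x ∂g) ^ (1 / x) := Real.rpow_pos_of_pos hg_pos _
  have hγm : ∀ n, AEMeasurable (γ n) μ := fun n => (hγ_law n).aemeasurable
  have hWm : AEMeasurable (fun ω n => (γ n ω * ξ n ω, γ n ω)) μ :=
    aemeasurable_pi_iff.2 fun n => ((hγm n).mul (hξ.aemeasurable n)).prodMk (hγm n)
  have hD : ∀ᵐ w ∂markedLaw x g ξ μ, w ∈ descendingConfigurations := by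
    have hm2 : Measurable fun (p : (ℕ → ℝ) × (ℕ → ℝ)) n =>
      ((∫ c, c ^ x ∂g) ^ (1 / x) * p.1 n, p.2 n) := by fun_prop
    have hm0 : Measurable fun (a : ℕ → ℝ) n =>
      ((∫ c, c ^ x ∂g) ^ (1 / x) * a n, (0 : ℝ)) := by fun_prop
    rw [markedLaw]
    refine (ae_map_iff (p := (· ∈ descendingConfigurations)) hm2.aemeasurable
      measurableSet_descendingConfigurations).2 ?_
    have h0 : ∀ᵐ a ∂(μ.map fun ω n => ξ n ω),
        (fun n => ((∫ c, c ^ x ∂g) ^ (1 / x) * a n, (0 : ℝ))) ∈ descendingConfigurations :=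
      (ae_map_iff hξm (hm0 measurableSet_descendingConfigurations)).2
        (hξ.ae_mem_descendingConfigurations hx hξ_desc hK 0)
    -- Membership depends on the positions only, so the mark zero may be replaced by any mark.
    filter_upwards [Measure.quasiMeasurePreserving_fst.ae h0] with p hp using hp
  refine ⟨hD, ?_⟩
  have hE : ∀ᵐ z ∂((μ.map fun ω n => (γ n ω * ξ n ω, γ n ω)).map countVector),
      z ∈ countVector '' descendingConfigurations := by
    rw [map_countVector_eq_markedLaw hx hg_nonneg hg_moment hg_pos hξ hγ_law hγ_indep hξγ]
    refine (ae_map_iff (p := (· ∈ countVector '' descendingConfigurations))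
      measurable_countVector.aemeasurable measurableSet_image_countVector).2 ?_
    filter_upwards [hD] with w hw using mem_image_of_mem _ hw
  have hγ0 : ∀ᵐ ω ∂μ, ∀ n, 0 ≤ γ n ω := by
    rw [ae_all_iff]
    exact fun n => ae_of_ae_map (hγm n) (by rw [(hγ_law n).map_eq]; exact hg_nonneg)
  filter_upwards [ae_of_ae_map hWm (ae_of_ae_map measurable_countVector.aemeasurable hE), hγ0,
    hξ.ae_pos] with ω ⟨d, hd, hdw⟩ h0 h1
  refine ⟨d, hd, hdw.symm, ?_⟩
  obtain ⟨σ, hσ, hwσ, hrange⟩ := exists_relabelling hd hdw.symm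
  have hfst : ∀ n, γ (σ n) ω * ξ (σ n) ω = (d n).1 := fun n => congrArg Prod.fst (hwσ n)
  refine ⟨σ, ⟨⟨fun n _ => ?_, hσ.injOn, fun k hk => ?_⟩, ?_⟩, funext hwσ⟩
  · rw [mem_ofPred_eq, hfst]
    exact (hd.2.1 n).ne'
  · rw [image_univ]
    exact hrange k (lt_of_le_of_ne (mul_nonneg (h0 k) (h1 k).le) (Ne.symm hk))
  · simp_rw [hfst]
    exact hd.1

/-- The descending relabelling of `(γₙξₙ, γₙ)` has the same law as `(Kξₙ, γ'ₙ)`. -/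
lemma hasLaw_relabelled [IsProbabilityMeasure μ] [IsProbabilityMeasure g] (hx : 0 < x)
    (hg_nonneg : ∀ᵐ c ∂g, 0 ≤ c) (hg_moment : Integrable (fun c : ℝ => c ^ x) g)
    (hg_pos : 0 < ∫ c, c ^ x ∂g) (hξ : IsREM x ξ μ)
    (hξ_desc : ∀ᵐ ω ∂μ, StrictAnti (fun n => ξ n ω))
    (hγ_law : ∀ n, HasLaw (γ n) g μ) (hγ_indep : iIndepFun γ μ)
    (hξγ : IndepFun (fun ω n => ξ n ω) (fun ω n => γ n ω) μ) {π : Ω → ℕ → ℕ}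
    (hπ : ∀ᵐ ω ∂μ, IsDescendingRelabelling (fun n => γ n ω * ξ n ω) (π ω)) :
    HasLaw (fun ω n => (γ (π ω n) ω * ξ (π ω n) ω, γ (π ω n) ω)) (markedLaw x g ξ μ) μ := by
  obtain ⟨hD, hE⟩ := ae_exists_descending hx hg_nonneg hg_moment hg_pos hξ hξ_desc hγ_law
    hγ_indep hξγ
  obtain ⟨R, hRm, hR⟩ := exists_measurable_leftInvOn_countVector
  have hγm : ∀ n, AEMeasurable (γ n) μ := fun n => (hγ_law n).aemeasurable
  have hWm : AEMeasurable (fun ω n => (γ n ω * ξ n ω, γ n ω)) μ :=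
    aemeasurable_pi_iff.2 fun n => ((hγm n).mul (hξ.aemeasurable n)).prodMk (hγm n)
  -- The relabelled configuration is a measurable function `R` of the counts of the raw one,
  -- whatever the dependence of `π` on `ω`; this also supplies the measurability.
  have hae : (fun ω n => (γ (π ω n) ω * ξ (π ω n) ω, γ (π ω n) ω)) =ᵐ[μ]
      fun ω => R (countVector fun n => (γ n ω * ξ n ω, γ n ω)) := by
    filter_upwards [hE, hπ] with ω ⟨d, hd, hdw, σ, hσ, hσd⟩ hπω
    rw [hdw, hR d hd, ← hσd, hσ.unique hπω]
  have hlaw : HasLaw (fun ω => R (countVector fun n => (γ n ω * ξ n ω, γ n ω)))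
      (markedLaw x g ξ μ) μ := by
    refine ⟨(hRm.comp measurable_countVector).comp_aemeasurable hWm, ?_⟩
    have h1 : μ.map (fun ω => R (countVector fun n => (γ n ω * ξ n ω, γ n ω))) =
        ((μ.map fun ω n => (γ n ω * ξ n ω, γ n ω)).map countVector).map R := by
      rw [Measure.map_map hRm measurable_countVector,
        AEMeasurable.map_map_of_aemeasurable (hRm.comp measurable_countVector).aemeasurable hWm]
      rfl
    rw [h1, map_countVector_eq_markedLaw hx hg_nonneg hg_moment hg_pos hξ hγ_law hγ_indep hξγ,
      Measure.map_map hRm measurable_countVector]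
    refine (Measure.map_congr ?_).trans Measure.map_id
    filter_upwards [hD] with w hw using hR w hw
  exact hlaw.congr hae

end Relabelling

theorem theorem4p2 {Ω : Type*} [MeasurableSpace Ω] (μ : Measure Ω) [IsProbabilityMeasure μ]
    (x : ℝ) (hx0 : 0 < x) (hx1 : x < 1)
    (g : Measure ℝ) [IsProbabilityMeasure g]
    (hg_nonneg : ∀ᵐ c ∂g, 0 ≤ c)
    (hg_moment : Integrable (fun c : ℝ => c ^ x) g)
    (hg_pos : 0 < ∫ c, c ^ x ∂g)
    (ξ : ℕ → Ω → ℝ) (hξ : IsREM x ξ μ)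
    (hξ_desc : ∀ᵐ ω ∂μ, StrictAnti (fun n => ξ n ω))
    (γ : ℕ → Ω → ℝ) (hγ_law : ∀ n, HasLaw (γ n) g μ) (hγ_indep : iIndepFun γ μ)
    (hξγ : IndepFun (fun ω n => ξ n ω) (fun ω n => γ n ω) μ) :
    (∀ᵐ ω ∂μ, ∃! σ : ℕ → ℕ, IsDescendingRelabelling (fun n => γ n ω * ξ n ω) σ) ∧
    ∀ π : Ω → ℕ → ℕ,
      (∀ᵐ ω ∂μ, IsDescendingRelabelling (fun n => γ n ω * ξ n ω) (π ω)) →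
      IdentDistrib
        (fun ω n => ((∫ c, c ^ x ∂g) ^ (1 / x))⁻¹ * (γ (π ω n) ω * ξ (π ω n) ω))
        (fun ω n => ξ n ω) μ μ ∧
      iIndepFun (fun n ω => γ (π ω n) ω) μ ∧
      (∀ n, HasLaw (fun ω => γ (π ω n) ω) (tiltedLaw x g) μ) ∧
      IndepFun (fun ω n => γ (π ω n) ω) (fun ω n => γ (π ω n) ω * ξ (π ω n) ω) μ := by
  refine ⟨?_, fun π hπ => ?_⟩
  · filter_upwards [(ae_exists_descending hx0 hg_nonneg hg_moment hg_pos hξ hξ_desc hγ_law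
      hγ_indep hξγ).2] with ω ⟨_, _, _, σ, hσ, _⟩
    exact ⟨σ, hσ, fun τ hτ => hτ.unique hσ⟩
  have hlaw := hasLaw_relabelled hx0 hg_nonneg hg_moment hg_pos hξ hξ_desc hγ_law
    hγ_indep hξγ hπ
  have htilt := isProbabilityMeasure_tiltedLaw hg_nonneg hg_moment hg_pos
  have hξm := aemeasurable_pi_iff.2 hξ.aemeasurable
  have hP : IsProbabilityMeasure (μ.map fun ω n => ξ n ω) := Measure.isProbabilityMeasure_map hξm
  have hK : 0 < (∫ c, c ^ x ∂g) ^ (1 / x) := Real.rpow_pos_of_pos hg_pos _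
  rw [markedLaw] at hlaw
  set K := (∫ c, c ^ x ∂g) ^ (1 / x) with hKdef
  -- Dividing the positions by `K` and separating them from the marks gives a product law.
  have hsplit : HasLaw (fun ω => ((fun n => K⁻¹ * (γ (π ω n) ω * ξ (π ω n) ω)),
      fun n => γ (π ω n) ω))
      ((μ.map fun ω n => ξ n ω).prod (Measure.infinitePi fun _ => tiltedLaw x g)) μ := by
    have hm : Measurable fun w : ℕ → ℝ × ℝ => ((fun n => K⁻¹ * (w n).1), fun n => (w n).2) := by
      fun_prop
    refine ⟨hm.comp_aemeasurable hlaw.aemeasurable, ?_⟩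
    have h1 := AEMeasurable.map_map_of_aemeasurable hm.aemeasurable hlaw.aemeasurable
    rw [hlaw.map_eq, Measure.map_map hm (by fun_prop)] at h1
    refine h1.symm.trans ((Measure.map_congr (ae_of_all _ fun p => ?_)).trans Measure.map_id)
    simp [inv_mul_cancel_left₀ hK.ne']
  have h1 : HasLaw (fun ω n => K⁻¹ * (γ (π ω n) ω * ξ (π ω n) ω)) (μ.map fun ω n => ξ n ω) μ :=
    ⟨hsplit.aemeasurable.fst, by
      rw [← Measure.fst_prod (μ := μ.map fun ω n => ξ n ω)
        (ν := Measure.infinitePi fun _ : ℕ => tiltedLaw x g), ← hsplit.map_eq, Measure.fst,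
        AEMeasurable.map_map_of_aemeasurable measurable_fst.aemeasurable hsplit.aemeasurable]
      rfl⟩
  have h2 : HasLaw (fun ω n => γ (π ω n) ω) (Measure.infinitePi fun _ => tiltedLaw x g) μ :=
    ⟨hsplit.aemeasurable.snd, by
      rw [← Measure.snd_prod (μ := μ.map fun ω n => ξ n ω)
        (ν := Measure.infinitePi fun _ : ℕ => tiltedLaw x g), ← hsplit.map_eq, Measure.snd,
        AEMeasurable.map_map_of_aemeasurable measurable_snd.aemeasurable hsplit.aemeasurable]
      rfl⟩
  have h3 : ∀ n, HasLaw (fun ω => γ (π ω n) ω) (tiltedLaw x g) μ := fun n =>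
    ⟨aemeasurable_pi_iff.1 h2.aemeasurable n, by
      rw [← (measurePreserving_eval_infinitePi (fun _ : ℕ => tiltedLaw x g) n).map_eq,
        ← h2.map_eq, AEMeasurable.map_map_of_aemeasurable (measurable_pi_apply n).aemeasurable
          h2.aemeasurable]
      rfl⟩
  refine ⟨⟨h1.aemeasurable, hξm, h1.map_eq⟩, ?_, h3, ?_⟩
  · rw [iIndepFun_iff_map_fun_eq_infinitePi_map₀ h2.aemeasurable, h2.map_eq]
    simp_rw [(h3 _).map_eq]
  · have hind : IndepFun (fun ω n => K⁻¹ * (γ (π ω n) ω * ξ (π ω n) ω))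
        (fun ω n => γ (π ω n) ω) μ := by
      rw [indepFun_iff_map_prod_eq_prod_map_map h1.aemeasurable h2.aemeasurable, hsplit.map_eq,
        h1.map_eq, h2.map_eq]
    have := hind.symm.comp (φ := id) (ψ := fun a n => K * a n) measurable_id (by fun_prop)
    simpa [Function.comp_def, mul_inv_cancel_left₀ hK.ne'] using this
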